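/- Scalars are real or complex. Let $(e_i)$ be an unconditional basic sequence in a Banach space, i.e. an unconditional Schauder basis of its closed linear span. A *normalized block-sequence* of a sequence $(f_i)$ is a sequence of norm-one vectors $x_k=\sum_i c_{k,i}f_i$ whose supports $\{i: c_{k,i}\ne 0\}$ are finite and successive (every element of the $k$-th support is smaller than every element of the $(k+1)$-st). Two sequences $(x_i)$, $(y_i)$ are *$C$-equivalent* ($C\ge 1$) if $C^{-1}\|\sum a_ix_i\|\le\|\sum a_iy_i\|\le C\|\sum a_ix_i\|$ for all finitely supported scalars $(a_i)$, and *equivalent* if they are $C$-equivalent for some $C$. For $1\le p<\infty$, $(e_i)$ is *asymptotically $\ell_p$* if there is a constant $C$ such that for every $n$ Player I has a winning strategy in the following game with $n$ rounds: in round $k$ Player I plays an integer $n_k$ and Player II plays a norm-one vector $x_k$ in the linear span of the $e_i$ with $\operatorname{supp}x_k>n_k$ and $\operatorname{supp} x_{k-1}<\operatorname{supp}x_k$; Player I wins if $(x_1,\dots,x_n)$ is $C$-equivalent to the unit vector basis of $\ell_p^n$. It is *asymptotically $c_0$* if the same holds with $\ell_\infty^n$ in place of $\ell_p^n$. **Proposition.**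 Suppose that every subsequence of $(e_i)$ has a normalized block-sequence equivalent to $(e_i)$. If $(e_i)$ is asymptotically $c_0$, then $(e_i)$ is equivalent to the unit vector basis of $c_0$; if $(e_i)$ is asymptotically $\ell_p$ for some $1\le p<\infty$, then $(e_i)$ is equivalent to the unit vector basis of $\ell_p$. Moreover, the hypothesis that every subsequence of $(e_i)$ has a normalized block-sequence equivalent to $(e_i)$ holds whenever the unconditional basic sequence $(e_i)$ is subsymmetric (equivalent to each of its subsequences), and also whenever it is equivalence block-minimal (every normalized block-sequence of $(e_i)$ has a further normalized block-sequence that is equivalent to $(e_i)$). -/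

import Mathlib

open scoped ENNReal

/-- `(e i)` is an unconditional basic sequence: it is an unconditional Schauder basis of its closed
linear span. -/
def IsUnconditionalBasicSequence (𝕜 : Type*) {X : Type*} [RCLike 𝕜] [NormedAddCommGroup X]
    [NormedSpace 𝕜 X] (e : ℕ → X) : Prop :=
  ∃ b : UnconditionalSchauderBasis ℕ 𝕜 (Submodule.span 𝕜 (Set.range e)).topologicalClosure,
    ∀ i, ((b i : (Submodule.span 𝕜 (Set.range e)).topologicalClosure) : X) = e i

/-- `C`-equivalence of two (finite or infinite) families: for all finitely supported scalars `a`,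
`‖∑ aᵢ xᵢ‖ ≤ C ‖∑ aᵢ yᵢ‖` and `‖∑ aᵢ yᵢ‖ ≤ C ‖∑ aᵢ xᵢ‖`. -/
def AreEquivalentWith (𝕜 : Type*) {ι X Y : Type*} [RCLike 𝕜] [NormedAddCommGroup X]
    [NormedSpace 𝕜 X] [NormedAddCommGroup Y] [NormedSpace 𝕜 Y] (C : ℝ) (x : ι → X) (y : ι → Y) :
    Prop :=
  ∀ a : ι →₀ 𝕜,
    ‖Finsupp.linearCombination 𝕜 x a‖ ≤ C * ‖Finsupp.linearCombination 𝕜 y a‖ ∧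
    ‖Finsupp.linearCombination 𝕜 y a‖ ≤ C * ‖Finsupp.linearCombination 𝕜 x a‖

/-- Equivalence of two families: `C`-equivalence for some `C ≥ 1`. -/
def AreEquivalent (𝕜 : Type*) {ι X Y : Type*} [RCLike 𝕜] [NormedAddCommGroup X]
    [NormedSpace 𝕜 X] [NormedAddCommGroup Y] [NormedSpace 𝕜 Y] (x : ι → X) (y : ι → Y) : Prop :=
  ∃ C : ℝ, 1 ≤ C ∧ AreEquivalentWith 𝕜 C x y

/-- `x` is a normalized block-sequence of `e` (finite, for `ι = Fin n`, or infinite, for `ι = ℕ`)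
with coefficients `c`: the supports of the `c k` are finite and successive, and the vectors
`x k = ∑ i, c k i • e i` have norm one. -/
def IsNormalizedBlockSequenceWith (𝕜 : Type*) {ι X : Type*} [LT ι] [RCLike 𝕜]
    [NormedAddCommGroup X] [NormedSpace 𝕜 X] (e : ℕ → X) (c : ι → ℕ →₀ 𝕜) (x : ι → X) : Prop :=
  (∀ k l, k < l → ∀ i ∈ (c k).support, ∀ j ∈ (c l).support, i < j) ∧
  (∀ k, x k = Finsupp.linearCombination 𝕜 e (c k)) ∧
  ∀ k, ‖x k‖ = 1

/-- `x` is a normalized (infinite) block-sequence of `e`. -/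
def IsNormalizedBlockSequence (𝕜 : Type*) {X : Type*} [RCLike 𝕜] [NormedAddCommGroup X]
    [NormedSpace 𝕜 X] (e x : ℕ → X) : Prop :=
  ∃ c : ℕ → ℕ →₀ 𝕜, IsNormalizedBlockSequenceWith 𝕜 e c x

/-- The unit vector basis of `ℓ_p(ι)`; for `ι = Fin n` this is the space `ℓ_p^n`. -/
noncomputable def lpUnitBasis (𝕜 ι : Type*) [RCLike 𝕜] [DecidableEq ι] (p : ℝ≥0∞) :
    ι → lp (fun _ : ι => 𝕜) p :=
  fun i => lp.single p i (1 : 𝕜)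

/-- The unit vector basis of `c₀`, the space of null sequences with the supremum norm. -/
noncomputable def c0UnitBasis (𝕜 : Type*) [RCLike 𝕜] (i : ℕ) : ZeroAtInftyContinuousMap ℕ 𝕜 where
  toFun := Pi.single i (1 : 𝕜)
  continuous_toFun := continuous_of_discreteTopology
  zero_at_infty' := by
    rw [Filter.cocompact_eq_cofinite]
    refine tendsto_const_nhds.congr' ?_
    filter_upwards [(Set.finite_singleton i).compl_mem_cofinite] with j hj
    exact (Pi.single_eq_of_ne (M := fun _ : ℕ => 𝕜) (by simpa using hj) 1).symm

/-- Player I has a winning strategy in the asymptotic game of length `n` on `e` for producing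
a sequence `C`-equivalent to the unit vector basis of `ℓ_p^n`. In round `k` Player I plays the
integer `σ [x 0, …, x (k-1)]`, and Player II answers with a unit vector `x k`, so that the `x k` are
successive blocks of `e` and the support of `x k` lies beyond the last integer played. -/
def PlayerIWinsAsymptoticGame (𝕜 : Type*) {X : Type*} [RCLike 𝕜] [NormedAddCommGroup X]
    [NormedSpace 𝕜 X] (e : ℕ → X) (p : ℝ≥0∞) [Fact (1 ≤ p)] (C : ℝ) (n : ℕ) : Prop :=
  ∃ σ : List X → ℕ, ∀ (c : Fin n → ℕ →₀ 𝕜) (x : Fin n → X),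
    IsNormalizedBlockSequenceWith 𝕜 e c x →
    (∀ k : Fin n, ∀ i ∈ (c k).support, σ ((List.ofFn x).take k) < i) →
    AreEquivalentWith 𝕜 C x (lpUnitBasis 𝕜 (Fin n) p)

/-- `e` is asymptotically `ℓ_p`, for `1 ≤ p < ∞`; asymptotically `c₀` for `p = ∞`. -/
def IsAsymptoticallyLp (𝕜 : Type*) {X : Type*} [RCLike 𝕜] [NormedAddCommGroup X]
    [NormedSpace 𝕜 X] (e : ℕ → X) (p : ℝ≥0∞) [Fact (1 ≤ p)] : Prop :=
  ∃ C : ℝ, 1 ≤ C ∧ ∀ n : ℕ, PlayerIWinsAsymptoticGame 𝕜 e p C n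

/-- `e` is asymptotically `c₀`: the definition above with `ℓ_∞^n`. -/
def IsAsymptoticallyC0 (𝕜 : Type*) {X : Type*} [RCLike 𝕜] [NormedAddCommGroup X]
    [NormedSpace 𝕜 X] (e : ℕ → X) : Prop :=
  IsAsymptoticallyLp 𝕜 e ∞

/-- Every subsequence of `e` has a normalized block-sequence equivalent to `e`. -/
def SubsequencesHaveEquivalentBlocks (𝕜 : Type*) {X : Type*} [RCLike 𝕜] [NormedAddCommGroup X]
    [NormedSpace 𝕜 X] (e : ℕ → X) : Prop :=
  ∀ φ : ℕ → ℕ, StrictMono φ →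
    ∃ x : ℕ → X, IsNormalizedBlockSequence 𝕜 (e ∘ φ) x ∧ AreEquivalent 𝕜 x e

/-- `e` is equivalent to each of its subsequences; for an unconditional basic sequence this is
subsymmetry. -/
def IsSubsymmetric (𝕜 : Type*) {X : Type*} [RCLike 𝕜] [NormedAddCommGroup X]
    [NormedSpace 𝕜 X] (e : ℕ → X) : Prop :=
  ∀ φ : ℕ → ℕ, StrictMono φ → AreEquivalent 𝕜 (e ∘ φ) e

/-- `e` is equivalence block-minimal: every normalized block-sequence of `e` has a further
normalized block-sequence equivalent to `e`. -/
def IsEquivalenceBlockMinimal (𝕜 : Type*) {X : Type*} [RCLike 𝕜] [NormedAddCommGroup X]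
    [NormedSpace 𝕜 X] (e : ℕ → X) : Prop :=
  ∀ y : ℕ → X, IsNormalizedBlockSequence 𝕜 e y →
    ∃ z : ℕ → X, IsNormalizedBlockSequence 𝕜 y z ∧ AreEquivalent 𝕜 z e

/-! Suppose `e` is not equivalent to the `ℓ_p` basis. Changing finitely many terms does not affect
equivalence, so for every `n` some segment of length `f n`, starting at `n + 1`, is not
`n`-equivalent to the `ℓ_p^{f n}` basis. Asymptoticity gives a subsequence `e ∘ φ` whose normalized
blocks of length `f n` beyond `n` are all `C`-equivalent to that basis, with `C` independent of `f`.
A block-sequence of `e ∘ φ` that is `D`-equivalent to `e` transfers this to the bad segments with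
constant `D * C`, which is absurd once `n ≥ D * C`.

The main difficulty is that Player I's strategy depends on the vectors played, not only on their
supports. Restricting Player II to finite nets of unit vectors leaves finitely many positions up to
each coordinate, so one gap function dominates the strategy
(`PlayerIWinsAsymptoticGame.exists_gap`); a perturbation costs a factor 2. Diagonalizing over `n`
gives `IsAsymptoticallyLp.exists_subsequence`. The case `p = ∞` covers `c₀`, since the norms agree
on finitely supported scalars. -/

/-! ### Unit vector bases of `ℓ_p` and `c₀` -/

section UnitVectorBases

variable {𝕜 ι κ : Type*} [RCLike 𝕜] [DecidableEq ι] [DecidableEq κ]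

theorem linearCombination_lpUnitBasis_apply (p : ℝ≥0∞) [Fact (1 ≤ p)] (a : ι →₀ 𝕜) (i : ι) :
    Finsupp.linearCombination 𝕜 (lpUnitBasis 𝕜 ι p) a i = a i := by
  induction a using Finsupp.induction_linear with
  | zero => simp
  | add f g hf hg => simp [hf, hg]
  | single j c =>
    by_cases h : i = j
    · subst h; simp [lpUnitBasis]
    · simp [lpUnitBasis, h]

theorem norm_apply_le_norm_linearCombination_lpUnitBasis (p : ℝ≥0∞) [Fact (1 ≤ p)] (a : ι →₀ 𝕜)
    (i : ι) : ‖a i‖ ≤ ‖Finsupp.linearCombination 𝕜 (lpUnitBasis 𝕜 ι p) a‖ := by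
  have hp : p ≠ 0 := (zero_lt_one.trans_le (Fact.out : 1 ≤ p)).ne'
  simpa [linearCombination_lpUnitBasis_apply] using
    lp.norm_apply_le_norm hp (Finsupp.linearCombination 𝕜 (lpUnitBasis 𝕜 ι p) a) i

theorem norm_linearCombination_lpUnitBasis_mono (p : ℝ≥0∞) [Fact (1 ≤ p)] {a b : ι →₀ 𝕜}
    (h : ∀ i, ‖a i‖ ≤ ‖b i‖) :
    ‖Finsupp.linearCombination 𝕜 (lpUnitBasis 𝕜 ι p) a‖ ≤
      ‖Finsupp.linearCombination 𝕜 (lpUnitBasis 𝕜 ι p) b‖ := by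
  have hp : p ≠ 0 := (zero_lt_one.trans_le (Fact.out : 1 ≤ p)).ne'
  exact lp.norm_mono hp fun i => by simpa [linearCombination_lpUnitBasis_apply] using h i

theorem norm_linearCombination_lpUnitBasis_embDomain (p : ℝ≥0∞) [Fact (1 ≤ p)] (f : ι ↪ κ)
    (a : ι →₀ 𝕜) :
    ‖Finsupp.linearCombination 𝕜 (lpUnitBasis 𝕜 κ p) (a.embDomain f)‖ =
      ‖Finsupp.linearCombination 𝕜 (lpUnitBasis 𝕜 ι p) a‖ := by
  by_cases hp : p = ∞
  · subst hp
    refine le_antisymm (lp.norm_le_of_forall_le (norm_nonneg _) fun k => ?_)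
      (lp.norm_le_of_forall_le (norm_nonneg _) fun i => ?_)
    · rw [linearCombination_lpUnitBasis_apply]
      by_cases hk : k ∈ Set.range f
      · obtain ⟨i, rfl⟩ := hk
        rw [Finsupp.embDomain_apply_self]
        exact norm_apply_le_norm_linearCombination_lpUnitBasis _ _ _
      · rw [Finsupp.embDomain_of_notMem_range _ _ _ hk, norm_zero]
        exact norm_nonneg _
    · rw [linearCombination_lpUnitBasis_apply, ← Finsupp.embDomain_apply_self f a i]
      exact norm_apply_le_norm_linearCombination_lpUnitBasis _ _ _
  · have h0 : 0 < p.toReal :=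
      ENNReal.toReal_pos (zero_lt_one.trans_le (Fact.out : 1 ≤ p)).ne' hp
    rw [lp.norm_eq_tsum_rpow h0, lp.norm_eq_tsum_rpow h0]
    congr 1
    simp only [linearCombination_lpUnitBasis_apply]
    rw [← f.injective.tsum_eq]
    · simp [Finsupp.embDomain_apply_self]
    · intro k hk
      by_contra hk'
      rw [Function.mem_support, Finsupp.embDomain_of_notMem_range _ _ _ hk', norm_zero,
        Real.zero_rpow h0.ne'] at hk
      exact hk rfl

theorem linearCombination_c0UnitBasis_apply (a : ℕ →₀ 𝕜) (i : ℕ) :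
    Finsupp.linearCombination 𝕜 (c0UnitBasis 𝕜) a i = a i := by
  induction a using Finsupp.induction_linear with
  | zero => simp
  | add f g hf hg => simp [hf, hg]
  | single j c =>
    have : c0UnitBasis 𝕜 j i = (Pi.single j (1 : 𝕜) : ℕ → 𝕜) i := rfl
    simp [this, Pi.single_apply, Finsupp.single_apply, eq_comm]

theorem norm_linearCombination_c0UnitBasis (a : ℕ →₀ 𝕜) :
    ‖Finsupp.linearCombination 𝕜 (c0UnitBasis 𝕜) a‖ =
      ‖Finsupp.linearCombination 𝕜 (lpUnitBasis 𝕜 ℕ ∞) a‖ := by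
  refine le_antisymm ?_ (lp.norm_le_of_forall_le (norm_nonneg _) fun i => ?_)
  · rw [← ZeroAtInftyContinuousMap.norm_toBCF_eq_norm,
      BoundedContinuousFunction.norm_le (norm_nonneg _)]
    intro i
    change ‖Finsupp.linearCombination 𝕜 (c0UnitBasis 𝕜) a i‖ ≤ _
    rw [linearCombination_c0UnitBasis_apply]
    exact norm_apply_le_norm_linearCombination_lpUnitBasis _ _ _
  · rw [linearCombination_lpUnitBasis_apply, ← linearCombination_c0UnitBasis_apply,
      ← ZeroAtInftyContinuousMap.norm_toBCF_eq_norm]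
    exact BoundedContinuousFunction.norm_coe_le_norm
      (Finsupp.linearCombination 𝕜 (c0UnitBasis 𝕜) a).toBCF i

end UnitVectorBases

/-! ### Suppression projections and bounded multipliers -/

section Unconditional

variable {𝕜 X : Type*} [RCLike 𝕜] [NormedAddCommGroup X] [NormedSpace 𝕜 X] {e : ℕ → X}

theorem IsUnconditionalBasicSequence.ne_zero (he : IsUnconditionalBasicSequence 𝕜 e) (i : ℕ) :
    e i ≠ 0 := by
  obtain ⟨b, hb⟩ := he
  rw [← hb i]
  exact fun h => b.linearIndependent.ne_zero i (Subtype.ext h)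

/-- The suppression projections of an unconditional basic sequence are uniformly bounded. -/
theorem IsUnconditionalBasicSequence.exists_norm_filter_le [CompleteSpace X]
    (he : IsUnconditionalBasicSequence 𝕜 e) :
    ∃ U : ℝ, 1 ≤ U ∧ ∀ (a : ℕ →₀ 𝕜) (A : Set ℕ) [DecidablePred (· ∈ A)],
      ‖Finsupp.linearCombination 𝕜 e (a.filter (· ∈ A))‖ ≤
        U * ‖Finsupp.linearCombination 𝕜 e a‖ := by
  classical
  obtain ⟨b, hb⟩ := he
  have : CompleteSpace (Submodule.span 𝕜 (Set.range e)).topologicalClosure :=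
    (Submodule.isClosed_topologicalClosure _).completeSpace_coe
  obtain ⟨U, hU⟩ := UnconditionalSchauderBasis.exists_norm_proj_le b
  have hlc (a : ℕ →₀ 𝕜) : ((Finsupp.linearCombination 𝕜 b a :
      (Submodule.span 𝕜 (Set.range e)).topologicalClosure) : X) =
      Finsupp.linearCombination 𝕜 e a := by
    simp [Finsupp.linearCombination_apply, Finsupp.sum, hb]
  refine ⟨max U 1, le_max_right _ _, fun a A _ => ?_⟩
  have hproj : b.proj (a.support.filter (· ∈ A)) (Finsupp.linearCombination 𝕜 b a) =
      Finsupp.linearCombination 𝕜 b (a.filter (· ∈ A)) := by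
    have hc (i : ℕ) : b.coord i (Finsupp.linearCombination 𝕜 b a) = a i := by
      simp [Finsupp.linearCombination_apply, Finsupp.sum, b.ortho, Pi.single_apply]
      exact fun h => h.symm
    simp only [GeneralSchauderBasis.proj_apply, hc]
    rw [Finsupp.linearCombination_apply, Finsupp.sum, Finsupp.support_filter]
    refine Finset.sum_congr rfl fun i hi => ?_
    rw [Finsupp.filter_apply_pos _ _ (Finset.mem_filter.1 hi).2]
  calc ‖Finsupp.linearCombination 𝕜 e (a.filter (· ∈ A))‖
      = ‖b.proj (a.support.filter (· ∈ A)) (Finsupp.linearCombination 𝕜 b a)‖ := by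
        rw [hproj, ← hlc, Submodule.coe_norm]
    _ ≤ U * ‖Finsupp.linearCombination 𝕜 b a‖ := (b.proj _).le_of_opNorm_le (hU _) _
    _ ≤ max U 1 * ‖Finsupp.linearCombination 𝕜 e a‖ := by
        rw [← hlc, Submodule.coe_norm]
        exact mul_le_mul_of_nonneg_right (le_max_left _ _) (norm_nonneg _)

/-- If all subsums of a finite sum have norm at most `B`, then so have all sums with coefficients
in `[0, 1]`. -/
theorem norm_sum_smul_le_of_norm_subsum_le {ι : Type*} (s : Finset ι) (v : ι → X) {B : ℝ}
    (hB : ∀ A ⊆ s, ‖∑ i ∈ A, v i‖ ≤ B) (t : ι → ℝ) (ht : ∀ i, 0 ≤ t i ∧ t i ≤ 1) :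
    ‖∑ i ∈ s, (t i : 𝕜) • v i‖ ≤ B := by
  classical
  -- Indices in `T` carry the weights `t`, those in `A` weight 1, all others weight 0. A new weight
  -- `t j` is a convex combination of `j` joining `A` and `j` being dropped.
  suffices h : ∀ T A : Finset ι, Disjoint T A → T ∪ A ⊆ s →
      ‖∑ i ∈ T, (t i : 𝕜) • v i + ∑ i ∈ A, v i‖ ≤ B by
    simpa using h s ∅ (by simp) (by simp)
  intro T
  induction T using Finset.induction_on with
  | empty => intro A _ hA; simpa using hB A (by simpa using hA)
  | insert j T hj ih =>
    intro A hd hs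
    rw [Finset.disjoint_insert_left] at hd
    have h1 := ih A hd.2 fun i hi => hs (by simp at hi ⊢; tauto)
    have h2 := ih (insert j A) (by rw [Finset.disjoint_insert_right]; exact ⟨hj, hd.2⟩)
      fun i hi => hs (by simp at hi ⊢; tauto)
    rw [Finset.sum_insert hd.1] at h2
    rw [Finset.sum_insert hj]
    set p := ∑ i ∈ T, (t i : 𝕜) • v i
    set q := ∑ i ∈ A, v i
    have key : (t j : 𝕜) • v j + p + q =
        (t j : 𝕜) • (p + (v j + q)) + ((1 - t j : ℝ) : 𝕜) • (p + q) := by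
      push_cast
      module
    rw [key]
    refine (norm_add_le _ _).trans ?_
    rw [norm_smul, norm_smul, RCLike.norm_ofReal, RCLike.norm_ofReal, abs_of_nonneg (ht j).1,
      abs_of_nonneg (by linarith [(ht j).2])]
    nlinarith [mul_le_mul_of_nonneg_left h2 (ht j).1,
      mul_le_mul_of_nonneg_left h1 (sub_nonneg.2 (ht j).2)]

/-- Nonnegative multipliers bounded by `M` act boundedly on a sequence with uniformly bounded
suppression projections. -/
theorem norm_linearCombination_ofReal_smul_le {U : ℝ}
    (hU : ∀ (a : ℕ →₀ 𝕜) (A : Set ℕ) [DecidablePred (· ∈ A)],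
      ‖Finsupp.linearCombination 𝕜 e (a.filter (· ∈ A))‖ ≤
        U * ‖Finsupp.linearCombination 𝕜 e a‖)
    {M : ℝ} (hM : 0 < M) (t : ℕ → ℝ) (ht : ∀ i, 0 ≤ t i ∧ t i ≤ M) (a : ℕ →₀ 𝕜) :
    ‖Finsupp.linearCombination 𝕜 e ((fun i => (t i : 𝕜)) • a)‖ ≤
      M * U * ‖Finsupp.linearCombination 𝕜 e a‖ := by
  classical
  have h1 : Finsupp.linearCombination 𝕜 e ((fun i => (t i : 𝕜)) • a) =
      (M : 𝕜) • ∑ i ∈ a.support, ((t i / M : ℝ) : 𝕜) • a i • e i := by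
    rw [Finsupp.linearCombination_apply, Finsupp.sum_of_support_subset (s := a.support),
      Finset.smul_sum]
    · refine Finset.sum_congr rfl fun i _ => ?_
      have : (M : 𝕜) ≠ 0 := by exact_mod_cast hM.ne'
      rw [Finsupp.coe_pointwise_smul, smul_smul, smul_smul]
      congr 1
      rw [Pi.smul_apply', smul_eq_mul]
      push_cast
      field_simp
    · intro i hi
      simp at hi ⊢
      exact hi.2
    · simp
  rw [h1, norm_smul, RCLike.norm_ofReal, abs_of_pos hM, mul_assoc]
  refine mul_le_mul_of_nonneg_left ?_ hM.le
  refine norm_sum_smul_le_of_norm_subsum_le _ _ (fun A hA => ?_) _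
    fun i => ⟨div_nonneg (ht i).1 hM.le, (div_le_one hM).2 (ht i).2⟩
  convert hU a (A : Set ℕ) using 2
  rw [Finsupp.linearCombination_apply, Finsupp.sum, Finsupp.support_filter]
  have : a.support.filter (· ∈ (A : Set ℕ)) = A := by
    ext i
    simpa using fun hi => Finsupp.mem_support_iff.1 (hA hi)
  rw [this]
  refine Finset.sum_congr rfl fun i hi => ?_
  rw [Finsupp.filter_apply_pos _ _ (by simpa using hi)]

end Unconditional

/-! ### From winning strategies to spread subsequences -/

section AsymptoticGame

variable {𝕜 X : Type*} [RCLike 𝕜] [NormedAddCommGroup X] [NormedSpace 𝕜 X] {e : ℕ → X}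

/-- Compactness of the unit sphere of a finite-dimensional span. Net points keep norm one and
support in `F`, so they remain legal moves in the game. -/
theorem exists_finite_net_unit_vectors (e : ℕ → X) (F : Finset ℕ) {δ : ℝ} (hδ : 0 < δ) :
    ∃ T : Set (ℕ →₀ 𝕜), T.Finite ∧
      (∀ c ∈ T, c.support ⊆ F ∧ ‖Finsupp.linearCombination 𝕜 e c‖ = 1) ∧
      ∀ c : ℕ →₀ 𝕜, c.support ⊆ F → ‖Finsupp.linearCombination 𝕜 e c‖ = 1 →
        ∃ c' ∈ T, ‖Finsupp.linearCombination 𝕜 e c - Finsupp.linearCombination 𝕜 e c'‖ ≤ δ := by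
  classical
  let V := Submodule.span 𝕜 (e '' (F : Set ℕ))
  have : FiniteDimensional 𝕜 V := FiniteDimensional.span_of_finite 𝕜 (F.finite_toSet.image e)
  have : ProperSpace V := FiniteDimensional.proper 𝕜 V
  have htb : TotallyBounded (Metric.sphere (0 : V) 1) := (isCompact_sphere _ _).totallyBounded
  obtain ⟨T, hTS, hTf, hT⟩ := Metric.exists_finite_isCover_of_totallyBounded
    (ε := ⟨δ, hδ.le⟩) (fun h => hδ.ne' (congrArg NNReal.toReal h)) htb
  have hcoef (v : V) : ∃ c : ℕ →₀ 𝕜, c.support ⊆ F ∧ Finsupp.linearCombination 𝕜 e c = v := by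
    obtain ⟨c, hc, hcv⟩ := (Finsupp.mem_span_image_iff_linearCombination 𝕜).1 v.2
    exact ⟨c, by simpa [Finsupp.mem_supported] using hc, hcv⟩
  choose r hr hrv using hcoef
  refine ⟨r '' T, hTf.image r, ?_, fun c hc hc1 => ?_⟩
  · rintro _ ⟨v, hv, rfl⟩
    refine ⟨hr v, ?_⟩
    rw [hrv]
    simpa using hTS hv
  · have hmem : Finsupp.linearCombination 𝕜 e c ∈ V :=
      (Finsupp.mem_span_image_iff_linearCombination 𝕜).2
        ⟨c, by simpa [Finsupp.mem_supported] using hc, rfl⟩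
    obtain ⟨v, hv, hd⟩ := hT (x := ⟨_, hmem⟩) (by simpa using hc1)
    refine ⟨r v, ⟨v, hv, rfl⟩, ?_⟩
    rw [hrv]
    have hd' : edist (⟨_, hmem⟩ : V) v ≤ ENNReal.ofReal δ := by
      rw [ENNReal.ofReal, Real.toNNReal_of_nonneg hδ.le]; exact hd
    rw [edist_dist, ENNReal.ofReal_le_ofReal_iff hδ.le, dist_eq_norm] at hd'
    simpa using hd'

theorem AreEquivalentWith.mono {ι Y Z : Type*} [NormedAddCommGroup Y] [NormedSpace 𝕜 Y]
    [NormedAddCommGroup Z] [NormedSpace 𝕜 Z] {C D : ℝ} {x : ι → Y} {y : ι → Z}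
    (h : AreEquivalentWith 𝕜 C x y) (hCD : C ≤ D) : AreEquivalentWith 𝕜 D x y := fun a =>
  ⟨(h a).1.trans (mul_le_mul_of_nonneg_right hCD (norm_nonneg _)),
    (h a).2.trans (mul_le_mul_of_nonneg_right hCD (norm_nonneg _))⟩

/-- A small perturbation of a finite sequence equivalent to the unit vector basis of `ℓ_p^m` is
still equivalent to it. -/
theorem AreEquivalentWith.of_norm_sub_le (p : ℝ≥0∞) [Fact (1 ≤ p)] {m : ℕ} {C δ : ℝ} (hC : 1 ≤ C)
    {x x' : Fin m → X} (hx' : AreEquivalentWith 𝕜 C x' (lpUnitBasis 𝕜 (Fin m) p))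
    (hδ : C * (m * δ) ≤ 1 / 2) (h : ∀ k, ‖x k - x' k‖ ≤ δ) :
    AreEquivalentWith 𝕜 (2 * C) x (lpUnitBasis 𝕜 (Fin m) p) := by
  intro a
  set P := ‖Finsupp.linearCombination 𝕜 (lpUnitBasis 𝕜 (Fin m) p) a‖
  have hP : 0 ≤ P := norm_nonneg _
  have hd : ‖Finsupp.linearCombination 𝕜 x a - Finsupp.linearCombination 𝕜 x' a‖ ≤
      m * δ * P := by
    rw [Finsupp.linearCombination_apply, Finsupp.linearCombination_apply,
      Finsupp.sum_fintype _ _ (by simp), Finsupp.sum_fintype _ _ (by simp),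
      ← Finset.sum_sub_distrib]
    refine (norm_sum_le_of_le _ (n := fun _ => δ * P) fun k _ => ?_).trans_eq ?_
    · rw [← smul_sub, norm_smul, mul_comm]
      exact mul_le_mul (h k) (norm_apply_le_norm_linearCombination_lpUnitBasis p a k)
        (norm_nonneg _) ((norm_nonneg _).trans (h k))
    · simp [mul_assoc]
  obtain ⟨h1, h2⟩ := hx' a
  have h3 : ‖Finsupp.linearCombination 𝕜 x a‖ ≤ ‖Finsupp.linearCombination 𝕜 x' a‖ +
      ‖Finsupp.linearCombination 𝕜 x a - Finsupp.linearCombination 𝕜 x' a‖ := by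
    rw [add_comm]; exact norm_le_norm_sub_add _ _
  have h4 : ‖Finsupp.linearCombination 𝕜 x' a‖ ≤ ‖Finsupp.linearCombination 𝕜 x a‖ +
      ‖Finsupp.linearCombination 𝕜 x a - Finsupp.linearCombination 𝕜 x' a‖ := by
    rw [add_comm, norm_sub_rev]; exact norm_le_norm_sub_add _ _
  have h5 : C * (m * δ * P) ≤ 1 / 2 * P := by
    rw [← mul_assoc]; exact mul_le_mul_of_nonneg_right hδ hP
  have h6 : m * δ * P ≤ C * (m * δ * P) :=
    le_mul_of_one_le_left ((norm_nonneg _).trans hd) hC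
  have h7 : P ≤ C * P := le_mul_of_one_le_left hP hC
  constructor
  · linarith
  -- The error term is at most `P / 2` and is absorbed into the left side.
  · have h8 : P ≤ C * (‖Finsupp.linearCombination 𝕜 x a‖ + m * δ * P) :=
      h2.trans (mul_le_mul_of_nonneg_left (by linarith) (by linarith))
    rw [mul_add] at h8
    linarith

/-- If Player I wins the asymptotic game of length `m`, then every sufficiently spread normalized
block sequence of length `m` is equivalent to the unit vector basis of `ℓ_p^m`; the gap needed
depends only on the position in `e`. -/
theorem PlayerIWinsAsymptoticGame.exists_gap {p : ℝ≥0∞} [Fact (1 ≤ p)] {C : ℝ} (hC : 1 ≤ C) {m : ℕ}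
    (hwin : PlayerIWinsAsymptoticGame 𝕜 e p C m) :
    ∃ g : ℕ → ℕ, ∀ (c : Fin m → ℕ →₀ 𝕜) (x : Fin m → X), IsNormalizedBlockSequenceWith 𝕜 e c x →
      (∀ k, ∀ i ∈ (c k).support, ∃ N, (∀ j < k, ∀ i' ∈ (c j).support, i' ≤ N) ∧ g N < i) →
      AreEquivalentWith 𝕜 (2 * C) x (lpUnitBasis 𝕜 (Fin m) p) := by
  classical
  obtain ⟨σ, hσ⟩ := hwin
  set δ : ℝ := 1 / (2 * C * (m + 1)) with hδdef
  have hCpos : 0 < C := by linarith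
  have hδ : 0 < δ := by positivity
  have hδ' : C * (m * δ) ≤ 1 / 2 := by
    rw [hδdef, ← mul_assoc, mul_one_div, div_le_div_iff₀ (by positivity) (by norm_num)]
    nlinarith
  choose T hTf hT hTnet using fun F : Finset ℕ => exists_finite_net_unit_vectors (𝕜 := 𝕜) e F hδ
  -- All net vectors supported in `[0, N]`. Only finitely many lists of length at most `m` arise
  -- from them, and `g N` will bound `σ` on these.
  let S : ℕ → Set X := fun N => ⋃ F ∈ (Finset.range (N + 1)).powerset,
    Finsupp.linearCombination 𝕜 e '' T F
  have hS (N : ℕ) : (S N).Finite :=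
    Set.Finite.biUnion (Finset.finite_toSet _) fun F _ => (hTf F).image _
  have hlist (N : ℕ) : {l : List X | l.length ≤ m ∧ ∀ y ∈ l, y ∈ S N}.Finite := by
    have := (hS N).to_subtype
    refine ((List.finite_length_le (S N) m).image (List.map Subtype.val)).subset ?_
    rintro l ⟨hl, hlS⟩
    lift l to List (S N) using hlS
    exact ⟨l, by simpa using hl, rfl⟩
  choose g hg using fun N => ((hlist N).image σ).bddAbove
  refine ⟨g, fun c x hx hgap => ?_⟩
  obtain ⟨hsucc, hxc, hx1⟩ := hx
  -- The net for the exact support of `c k` is used, so the approximating run inherits both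
  -- successiveness and the gaps.
  choose c' hc'T hc' using fun k =>
    hTnet (c k).support (c k) subset_rfl (by rw [← hxc]; exact hx1 k)
  have hsupp (k : Fin m) : (c' k).support ⊆ (c k).support := (hT _ _ (hc'T k)).1
  refine AreEquivalentWith.of_norm_sub_le p hC (hσ c'
    (fun k => Finsupp.linearCombination 𝕜 e (c' k))
    ⟨fun k l hkl i hi j hj => hsucc k l hkl i (hsupp k hi) j (hsupp l hj), fun _ => rfl,
      fun k => (hT _ _ (hc'T k)).2⟩ fun k i hi => ?_) hδ' fun k => by rw [hxc]; exact hc' k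
  obtain ⟨N, hN, hgN⟩ := hgap k i (hsupp k hi)
  refine lt_of_le_of_lt (hg N ⟨_, ⟨?_, fun y hy => ?_⟩, rfl⟩) hgN
  · simp
  · obtain ⟨j, hj, rfl⟩ := List.mem_take_iff_getElem.1 hy
    simp only [List.length_ofFn, lt_inf_iff] at hj
    rw [List.getElem_ofFn]
    refine Set.mem_biUnion (x := (c ⟨j, hj.2⟩).support) ?_ ⟨_, hc'T _, rfl⟩
    simp only [Finset.coe_powerset, Set.mem_preimage, Set.mem_powerset_iff, Finset.coe_subset]
    intro i' hi'
    exact Finset.mem_range_succ_iff.2 (hN ⟨j, hj.2⟩ hj.1 i' hi')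

/-- Diagonalization: step `i` has to beat only the finitely many gap functions with `n ≤ i`, hence
their sum. -/
theorem exists_strictMono_forall_lt (G : ℕ → ℕ → ℕ) :
    ∃ φ : ℕ → ℕ, StrictMono φ ∧ ∀ n i, n ≤ i → G n (φ i) < φ (i + 1) := by
  let φ : ℕ → ℕ := fun i =>
    Nat.rec 0 (fun i y => y + ∑ n ∈ Finset.range (i + 1), G n y + 1) i
  have hφ (i : ℕ) : φ (i + 1) = φ i + ∑ n ∈ Finset.range (i + 1), G n (φ i) + 1 := rfl
  refine ⟨φ, strictMono_nat_of_lt_succ fun i => by rw [hφ]; omega, fun n i hni => ?_⟩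
  have := Finset.single_le_sum (f := fun n => G n (φ i)) (fun _ _ => Nat.zero_le _)
    (Finset.mem_range.2 (Nat.lt_succ_of_le hni) : n ∈ Finset.range (i + 1))
  rw [hφ]
  omega

/-- An asymptotically `ℓ_p` sequence has, for every `f`, a subsequence whose normalized blocks of
length `f n` supported after `n` are uniformly equivalent to the unit vector basis of
`ℓ_p^{f n}`. -/
theorem IsAsymptoticallyLp.exists_subsequence {p : ℝ≥0∞} [Fact (1 ≤ p)]
    (h : IsAsymptoticallyLp 𝕜 e p) :
    ∃ C : ℝ, 1 ≤ C ∧ ∀ f : ℕ → ℕ, ∃ φ : ℕ → ℕ, StrictMono φ ∧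
      ∀ (n : ℕ) (c : Fin (f n) → ℕ →₀ 𝕜) (x : Fin (f n) → X),
        IsNormalizedBlockSequenceWith 𝕜 (e ∘ φ) c x → (∀ k, ∀ i ∈ (c k).support, n < i) →
        AreEquivalentWith 𝕜 C x (lpUnitBasis 𝕜 (Fin (f n)) p) := by
  classical
  obtain ⟨C, hC, hwin⟩ := h
  refine ⟨2 * C, by linarith, fun f => ?_⟩
  choose g hg using fun n => (hwin (f n)).exists_gap hC
  obtain ⟨φ, hφ, hφg⟩ := exists_strictMono_forall_lt g
  refine ⟨φ, hφ, fun n c x hx hn => hg n (fun k => (c k).embDomain ⟨φ, hφ.injective⟩) x ?_ ?_⟩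
  · obtain ⟨hsucc, hxc, hx1⟩ := hx
    refine ⟨fun k l hkl i hi j hj => ?_, fun k => ?_, hx1⟩
    · rw [Finsupp.support_embDomain, Finset.mem_map] at hi hj
      obtain ⟨i, hi, rfl⟩ := hi
      obtain ⟨j, hj, rfl⟩ := hj
      exact hφ (hsucc k l hkl i hi j hj)
    · rw [hxc, Finsupp.linearCombination_embDomain]
      rfl
  · intro k i hi
    rw [Finsupp.support_embDomain, Finset.mem_map] at hi
    obtain ⟨i, hi, rfl⟩ := hi
    have hni := hn k i hi
    -- As `i` exceeds `n`, its predecessor is at least `n` and bounds all earlier supports, so the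
    -- gap after it is large enough for `g n`.
    obtain ⟨i, rfl⟩ : ∃ i', i = i' + 1 := ⟨i - 1, by omega⟩
    refine ⟨φ i, fun j hj i' hi' => ?_, hφg n i (by omega)⟩
    rw [Finsupp.support_embDomain, Finset.mem_map] at hi'
    obtain ⟨i', hi', rfl⟩ := hi'
    exact hφ.monotone (Nat.lt_succ_iff.1 (hx.1 j k hj i' hi' _ hi))

end AsymptoticGame

/-! ### Tails, and the contradiction argument -/

section Equivalence

variable {𝕜 ι κ X Y Z : Type*} [RCLike 𝕜] [NormedAddCommGroup X] [NormedSpace 𝕜 X]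
  [NormedAddCommGroup Y] [NormedSpace 𝕜 Y] [NormedAddCommGroup Z] [NormedSpace 𝕜 Z]

theorem AreEquivalentWith.symm {C : ℝ} {x : ι → X} {y : ι → Y} (h : AreEquivalentWith 𝕜 C x y) :
    AreEquivalentWith 𝕜 C y x := fun a => (h a).symm

theorem AreEquivalentWith.trans {C D : ℝ} {x : ι → X} {y : ι → Y} {z : ι → Z} (hC : 0 ≤ C)
    (hD : 0 ≤ D) (h : AreEquivalentWith 𝕜 C x y) (h' : AreEquivalentWith 𝕜 D y z) :
    AreEquivalentWith 𝕜 (C * D) x z := fun a =>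
  ⟨(h a).1.trans ((mul_le_mul_of_nonneg_left (h' a).1 hC).trans_eq (mul_assoc _ _ _).symm),
    (h' a).2.trans ((mul_le_mul_of_nonneg_left (h a).2 hD).trans_eq (by ring))⟩

theorem AreEquivalentWith.comp_embedding {C : ℝ} {x : ι → X} {y : ι → Y}
    (h : AreEquivalentWith 𝕜 C x y) (f : κ ↪ ι) :
    AreEquivalentWith 𝕜 C (fun k => x (f k)) (fun k => y (f k)) := fun a => by
  have := h (a.embDomain f)
  rwa [Finsupp.linearCombination_embDomain, Finsupp.linearCombination_embDomain] at this

/-- Domination of the tail extends to the whole sequence. -/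
theorem exists_norm_linearCombination_le_of_tail {y : ℕ → Y} {z : ℕ → Z} {D : ℕ → ℝ} {U K : ℝ}
    {n : ℕ} (hK : 0 ≤ K)
    (hD : ∀ (a : ℕ →₀ 𝕜) (i : ℕ), ‖a i‖ ≤ D i * ‖Finsupp.linearCombination 𝕜 z a‖)
    (hU : ∀ a : ℕ →₀ 𝕜, ‖Finsupp.linearCombination 𝕜 z (a.filter (n ≤ ·))‖ ≤
      U * ‖Finsupp.linearCombination 𝕜 z a‖)
    (h : ∀ a : ℕ →₀ 𝕜, ‖Finsupp.linearCombination 𝕜 y (a.filter (n ≤ ·))‖ ≤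
      K * ‖Finsupp.linearCombination 𝕜 z (a.filter (n ≤ ·))‖) :
    ∃ C : ℝ, ∀ a : ℕ →₀ 𝕜,
      ‖Finsupp.linearCombination 𝕜 y a‖ ≤ C * ‖Finsupp.linearCombination 𝕜 z a‖ := by
  refine ⟨∑ i ∈ Finset.range n, D i * ‖y i‖ + K * U, fun a => ?_⟩
  have hhead : ‖Finsupp.linearCombination 𝕜 y (a.filter fun i => ¬ n ≤ i)‖ ≤
      ∑ i ∈ Finset.range n, D i * ‖y i‖ * ‖Finsupp.linearCombination 𝕜 z a‖ := by
    rw [Finsupp.linearCombination_apply, Finsupp.sum_of_support_subset (s := Finset.range n)]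
    · refine norm_sum_le_of_le _ fun i hi => ?_
      rw [Finsupp.filter_apply_pos _ _ (by simpa using hi), norm_smul, mul_right_comm]
      exact mul_le_mul_of_nonneg_right (hD a i) (norm_nonneg _)
    · intro i hi
      simp only [Finsupp.support_filter, Finset.mem_filter] at hi
      simpa using hi.2
    · simp
  rw [add_mul, Finset.sum_mul]
  calc ‖Finsupp.linearCombination 𝕜 y a‖
      = ‖Finsupp.linearCombination 𝕜 y (a.filter fun i => ¬ n ≤ i) +
          Finsupp.linearCombination 𝕜 y (a.filter (n ≤ ·))‖ := by
        rw [← map_add, add_comm, Finsupp.filter_add_filter_not]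
    _ ≤ _ := (norm_add_le _ _).trans (add_le_add hhead ((h a).trans
        ((mul_le_mul_of_nonneg_left (hU a) hK).trans_eq (mul_assoc _ _ _).symm)))

variable {e : ℕ → X}

theorem IsUnconditionalBasicSequence.areEquivalent_lpUnitBasis_of_tail [CompleteSpace X]
    (he : IsUnconditionalBasicSequence 𝕜 e) {p : ℝ≥0∞} [Fact (1 ≤ p)] {n : ℕ} {K : ℝ} (hK : 0 ≤ K)
    (h : ∀ m, AreEquivalentWith 𝕜 K (fun j : Fin m => e (n + j)) (lpUnitBasis 𝕜 (Fin m) p)) :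
    AreEquivalent 𝕜 e (lpUnitBasis 𝕜 ℕ p) := by
  classical
  obtain ⟨U, -, hU⟩ := he.exists_norm_filter_le
  have htail (a : ℕ →₀ 𝕜) : ‖Finsupp.linearCombination 𝕜 e (a.filter (n ≤ ·))‖ ≤
      K * ‖Finsupp.linearCombination 𝕜 (lpUnitBasis 𝕜 ℕ p) (a.filter (n ≤ ·))‖ ∧
      ‖Finsupp.linearCombination 𝕜 (lpUnitBasis 𝕜 ℕ p) (a.filter (n ≤ ·))‖ ≤
      K * ‖Finsupp.linearCombination 𝕜 e (a.filter (n ≤ ·))‖ := by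
    -- Long enough for the window `[n, n + m)` to contain the support of the tail of `a`.
    let m := a.support.sup id + 1
    let f : Fin m ↪ ℕ := ⟨fun j => n + j, fun i j hij => by simpa [Fin.ext_iff] using hij⟩
    have hf : ((a.filter (n ≤ ·)).support : Set ℕ) ⊆ Set.range f := by
      intro i hi
      simp only [Finsupp.support_filter, Finset.mem_coe, Finset.mem_filter] at hi
      have := Finset.le_sup (f := id) hi.1
      exact ⟨⟨i - n, by simp only [id] at this; omega⟩,
        Nat.add_sub_cancel' hi.2⟩
    obtain ⟨b, hb⟩ : ∃ b : Fin m →₀ 𝕜, b.embDomain f = a.filter (n ≤ ·) :=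
      ⟨_, Finsupp.embDomain_comapDomain hf⟩
    have := h m b
    rwa [← norm_linearCombination_lpUnitBasis_embDomain p f b, hb,
      show (fun j : Fin m => e (n + j)) = e ∘ f from rfl,
      ← Finsupp.linearCombination_embDomain, hb] at this
  have hcoord (a : ℕ →₀ 𝕜) (i : ℕ) : ‖a i‖ ≤ U / ‖e i‖ * ‖Finsupp.linearCombination 𝕜 e a‖ := by
    have hi := norm_pos_iff.2 (he.ne_zero i)
    have h1 := hU a {i}
    have h2 : a.filter (· ∈ ({i} : Set ℕ)) = Finsupp.single i (a i) := by
      ext j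
      by_cases hj : j = i
      · subst hj; simp
      · rw [Finsupp.filter_apply_neg _ _ (by simpa using hj), Finsupp.single_eq_of_ne hj]
    rw [h2, Finsupp.linearCombination_single, norm_smul] at h1
    rw [div_mul_eq_mul_div, le_div_iff₀ hi]
    exact h1
  obtain ⟨C₁, h₁⟩ := exists_norm_linearCombination_le_of_tail (𝕜 := 𝕜) (D := fun _ => 1) (U := 1)
    hK (fun a i => by
      rw [one_mul]; exact norm_apply_le_norm_linearCombination_lpUnitBasis p a i)
    (fun a => by
      rw [one_mul]
      refine norm_linearCombination_lpUnitBasis_mono p fun i => ?_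
      rw [Finsupp.filter_apply]
      split_ifs <;> simp) fun a => (htail a).1
  obtain ⟨C₂, h₂⟩ := exists_norm_linearCombination_le_of_tail (𝕜 := 𝕜) (U := U) hK hcoord
    (fun a => hU a (Set.Ici n)) fun a => (htail a).2
  refine ⟨max 1 (max C₁ C₂), le_max_left _ _, fun a => ⟨(h₁ a).trans ?_, (h₂ a).trans ?_⟩⟩
  · exact mul_le_mul_of_nonneg_right (by simp) (norm_nonneg _)
  · exact mul_le_mul_of_nonneg_right (by simp) (norm_nonneg _)

/-- Norm one makes each support nonempty, so successive supports advance by at least one. -/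
theorem IsNormalizedBlockSequenceWith.le_of_mem_support {c : ℕ → ℕ →₀ 𝕜} {x : ℕ → X}
    (h : IsNormalizedBlockSequenceWith 𝕜 e c x) (k : ℕ) : ∀ i ∈ (c k).support, k ≤ i := by
  induction k with
  | zero => simp
  | succ k ih =>
    intro i hi
    have hne : (c k).support.Nonempty := by
      rw [Finsupp.support_nonempty_iff]
      intro h0
      simpa [h.2.1 k, h0] using h.2.2 k
    obtain ⟨j, hj⟩ := hne
    exact (ih j hj).trans_lt (h.1 k (k + 1) k.lt_succ_self j hj i hi)

theorem IsAsymptoticallyLp.areEquivalent_lpUnitBasis [CompleteSpace X]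
    (he : IsUnconditionalBasicSequence 𝕜 e) (hsub : SubsequencesHaveEquivalentBlocks 𝕜 e)
    {p : ℝ≥0∞} [Fact (1 ≤ p)] (h : IsAsymptoticallyLp 𝕜 e p) :
    AreEquivalent 𝕜 e (lpUnitBasis 𝕜 ℕ p) := by
  by_contra hne
  -- The shift `n + 1` puts the matching blocks strictly beyond `n`.
  have hf (n : ℕ) : ∃ m : ℕ, ¬ AreEquivalentWith 𝕜 n (fun j : Fin m => e (n + 1 + j))
      (lpUnitBasis 𝕜 (Fin m) p) := by
    by_contra! hn
    exact hne (he.areEquivalent_lpUnitBasis_of_tail n.cast_nonneg hn)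
  choose f hf using hf
  obtain ⟨C, hC, hsubseq⟩ := h.exists_subsequence
  obtain ⟨φ, hφ, hblock⟩ := hsubseq f
  obtain ⟨x, ⟨c, hx⟩, D, hD, hxe⟩ := hsub φ hφ
  obtain ⟨n, hn⟩ := exists_nat_ge (D * C)
  refine hf n (AreEquivalentWith.mono ?_ hn)
  let g : Fin (f n) ↪ ℕ := ⟨fun j => n + 1 + j, fun i j hij => by simpa [Fin.ext_iff] using hij⟩
  refine (hxe.symm.comp_embedding g).trans (by linarith) (by linarith)
    (hblock n (fun k => c (g k)) (fun k => x (g k)) ⟨fun k l hkl => hx.1 _ _ ?_, fun k => hx.2.1 _,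
      fun k => hx.2.2 _⟩ fun k i hi => ?_)
  · exact Nat.add_lt_add_left hkl _
  · have hk : n < g k := show n < n + 1 + (k : ℕ) by omega
    exact hk.trans_le (hx.le_of_mem_support _ i hi)

/-! ### Subsymmetric and block-minimal sequences -/

/-- An unbounded `u` has a subsequence with `u (φ n) > n * u n`, defeating every `C`. Applied to the
norms and their inverses, this shows that a subsymmetric sequence is seminormalized. -/
theorem bddAbove_range_of_forall_subsequence_le {u : ℕ → ℝ} (hu : ∀ i, 0 < u i)
    (h : ∀ φ : ℕ → ℕ, StrictMono φ → ∃ C : ℝ, ∀ n, u (φ n) ≤ C * u n) :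
    BddAbove (Set.range u) := by
  by_contra hb
  have hfreq (n : ℕ) : ∃ᶠ k in Filter.atTop, n * u n < u k := by
    intro hev
    refine hb (Filter.IsBoundedUnder.bddAbove_range ⟨n * u n, ?_⟩)
    rw [Filter.eventually_map]
    exact hev.mono fun k hk => not_lt.1 hk
  obtain ⟨φ, hφ, hφu⟩ := Filter.extraction_forall_of_frequently hfreq
  obtain ⟨C, hC⟩ := h φ hφ
  obtain ⟨n, hn⟩ := exists_nat_ge C
  exact ((hC n).trans (mul_le_mul_of_nonneg_right hn (hu n).le)).not_gt (hφu n)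

theorem IsSubsymmetric.subsequencesHaveEquivalentBlocks [CompleteSpace X]
    (he : IsUnconditionalBasicSequence 𝕜 e) (h : IsSubsymmetric 𝕜 e) :
    SubsequencesHaveEquivalentBlocks 𝕜 e := by
  classical
  obtain ⟨U, hU1, hU⟩ := he.exists_norm_filter_le
  have hUpos : 0 < U := by linarith
  have hpos (i : ℕ) : 0 < ‖e i‖ := norm_pos_iff.2 (he.ne_zero i)
  have hnorm (φ : ℕ → ℕ) (hφ : StrictMono φ) : ∃ C : ℝ, 1 ≤ C ∧ ∀ n,
      ‖e (φ n)‖ ≤ C * ‖e n‖ ∧ ‖e n‖ ≤ C * ‖e (φ n)‖ := by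
    obtain ⟨C, hC, hCe⟩ := h φ hφ
    exact ⟨C, hC, fun n => by simpa using hCe (Finsupp.single n 1)⟩
  obtain ⟨M, hM⟩ := bddAbove_range_of_forall_subsequence_le (u := fun i => ‖e i‖) hpos
    fun φ hφ => (hnorm φ hφ).imp fun C hC n => (hC.2 n).1
  obtain ⟨L, hL⟩ := bddAbove_range_of_forall_subsequence_le (u := fun i => ‖e i‖⁻¹)
    (fun i => inv_pos.2 (hpos i)) fun φ hφ => by
      obtain ⟨C, hC, hCe⟩ := hnorm φ hφ
      refine ⟨C, fun n => ?_⟩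
      rw [← div_eq_mul_inv, le_div_iff₀ (hpos n), inv_mul_le_iff₀ (hpos _), mul_comm]
      exact (hCe n).2
  have hMpos : 0 < M := (hpos 0).trans_le (hM ⟨0, rfl⟩)
  have hLpos : 0 < L := (inv_pos.2 (hpos 0)).trans_le (hL ⟨0, rfl⟩)
  intro φ hφ
  obtain ⟨C, hC, hCe⟩ := h φ hφ
  -- The normalized subsequence itself serves. Rescaling by the inverse norms costs `L * U`, undoing
  -- it costs `M * U`, and passing between `e ∘ φ` and `e` costs `C`.
  refine ⟨fun k => ((‖e (φ k)‖⁻¹ : ℝ) : 𝕜) • e (φ k),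
    ⟨fun k => Finsupp.single k ((‖e (φ k)‖⁻¹ : ℝ) : 𝕜), fun k l hkl i hi j hj => ?_,
      fun k => by simp, fun k => ?_⟩, max 1 (max (C * (L * U)) (M * U * C)), le_max_left _ _,
      fun a => ?_⟩
  · rw [Finset.mem_singleton.1 (Finsupp.support_single_subset hi),
      Finset.mem_singleton.1 (Finsupp.support_single_subset hj)]
    exact hkl
  · rw [norm_smul, RCLike.norm_ofReal, abs_of_pos (inv_pos.2 (hpos _)),
      inv_mul_cancel₀ (hpos _).ne']
  set s : ℕ →₀ 𝕜 := (fun i => ((‖e (φ i)‖⁻¹ : ℝ) : 𝕜)) • a with hs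
  have hxs : Finsupp.linearCombination 𝕜 (fun k => ((‖e (φ k)‖⁻¹ : ℝ) : 𝕜) • e (φ k)) a =
      Finsupp.linearCombination 𝕜 (e ∘ φ) s := by
    rw [Finsupp.linearCombination_apply, Finsupp.linearCombination_apply,
      Finsupp.sum_of_support_subset (s := a.support) s]
    · refine Finset.sum_congr rfl fun i _ => ?_
      rw [hs, Finsupp.coe_pointwise_smul, Pi.smul_apply', smul_eq_mul, mul_comm, mul_smul]
      rfl
    · intro i hi
      rw [hs, Finsupp.mem_support_iff, Finsupp.coe_pointwise_smul, Pi.smul_apply',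
        smul_eq_mul] at hi
      exact Finsupp.mem_support_iff.2 (right_ne_zero_of_mul hi)
    · simp
  have has : a = (fun i => ((‖e (φ i)‖ : ℝ) : 𝕜)) • s := by
    ext i
    rw [hs, Finsupp.coe_pointwise_smul, Finsupp.coe_pointwise_smul, Pi.smul_apply',
      Pi.smul_apply', smul_smul, smul_eq_mul, ← RCLike.ofReal_mul, mul_inv_cancel₀ (hpos _).ne',
      RCLike.ofReal_one, one_mul]
  have h1 := norm_linearCombination_ofReal_smul_le hU hLpos (fun i => ‖e (φ i)‖⁻¹)
    (fun i => ⟨(inv_pos.2 (hpos _)).le, hL ⟨φ i, rfl⟩⟩) a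
  have h2 := norm_linearCombination_ofReal_smul_le hU hMpos (fun i => ‖e (φ i)‖)
    (fun i => ⟨norm_nonneg _, hM ⟨φ i, rfl⟩⟩) s
  rw [← hs] at h1
  rw [← has] at h2
  obtain ⟨h3, h4⟩ := hCe s
  rw [hxs]
  constructor
  · calc _ ≤ C * (L * U * ‖Finsupp.linearCombination 𝕜 e a‖) :=
          h3.trans (mul_le_mul_of_nonneg_left h1 (by linarith))
      _ = C * (L * U) * ‖Finsupp.linearCombination 𝕜 e a‖ := by ring
      _ ≤ _ := mul_le_mul_of_nonneg_right (by simp) (norm_nonneg _)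
  · calc _ ≤ M * U * (C * ‖Finsupp.linearCombination 𝕜 (e ∘ φ) s‖) :=
          h2.trans (mul_le_mul_of_nonneg_left h4 (by positivity))
      _ = M * U * C * ‖Finsupp.linearCombination 𝕜 (e ∘ φ) s‖ := by ring
      _ ≤ _ := mul_le_mul_of_nonneg_right (by simp) (norm_nonneg _)

theorem IsEquivalenceBlockMinimal.subsequencesHaveEquivalentBlocks
    (he : IsUnconditionalBasicSequence 𝕜 e) (h : IsEquivalenceBlockMinimal 𝕜 e) :
    SubsequencesHaveEquivalentBlocks 𝕜 e := by
  intro φ hφ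
  have hpos (i : ℕ) : 0 < ‖e i‖ := norm_pos_iff.2 (he.ne_zero i)
  obtain ⟨z, ⟨d, hd, hzd, hz1⟩, hze⟩ := h (fun k => ((‖e (φ k)‖⁻¹ : ℝ) : 𝕜) • e (φ k))
    ⟨fun k => Finsupp.single (φ k) ((‖e (φ k)‖⁻¹ : ℝ) : 𝕜), fun k l hkl i hi j hj => by
      rw [Finset.mem_singleton.1 (Finsupp.support_single_subset hi),
        Finset.mem_singleton.1 (Finsupp.support_single_subset hj)]
      exact hφ hkl, fun k => by simp, fun k => by
      rw [norm_smul, RCLike.norm_ofReal, abs_of_pos (inv_pos.2 (hpos _)),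
        inv_mul_cancel₀ (hpos _).ne']⟩
  have hsupp (k : ℕ) : ((fun i => ((‖e (φ i)‖⁻¹ : ℝ) : 𝕜)) • d k).support ⊆ (d k).support := by
    intro i hi
    rw [Finsupp.mem_support_iff, Finsupp.coe_pointwise_smul, Pi.smul_apply', smul_eq_mul] at hi
    exact Finsupp.mem_support_iff.2 (right_ne_zero_of_mul hi)
  -- Blocks of the normalized subsequence are blocks of `e ∘ φ` once the norming factors are
  -- absorbed into the coefficients.
  refine ⟨z, ⟨fun k => (fun i => ((‖e (φ i)‖⁻¹ : ℝ) : 𝕜)) • d k,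
    fun k l hkl i hi j hj => hd k l hkl i (hsupp k hi) j (hsupp l hj), fun k => ?_, hz1⟩, hze⟩
  rw [hzd, Finsupp.linearCombination_apply, Finsupp.linearCombination_apply,
    Finsupp.sum_of_support_subset _ (hsupp k) _ (by simp)]
  refine Finset.sum_congr rfl fun i _ => ?_
  rw [Finsupp.coe_pointwise_smul, Pi.smul_apply', smul_eq_mul, mul_comm, mul_smul]
  rfl

end Equivalence

theorem mainTheorem10 {𝕜 X : Type*} [RCLike 𝕜] [NormedAddCommGroup X] [NormedSpace 𝕜 X]
    [CompleteSpace X] (e : ℕ → X) (he : IsUnconditionalBasicSequence 𝕜 e) :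
    (SubsequencesHaveEquivalentBlocks 𝕜 e →
      (IsAsymptoticallyC0 𝕜 e → AreEquivalent 𝕜 e (c0UnitBasis 𝕜)) ∧
      (∀ (p : ℝ≥0∞) [Fact (1 ≤ p)], p ≠ ∞ →
        IsAsymptoticallyLp 𝕜 e p → AreEquivalent 𝕜 e (lpUnitBasis 𝕜 ℕ p))) ∧
    (IsSubsymmetric 𝕜 e → SubsequencesHaveEquivalentBlocks 𝕜 e) ∧
    (IsEquivalenceBlockMinimal 𝕜 e → SubsequencesHaveEquivalentBlocks 𝕜 e) := by
  refine ⟨fun hsub => ⟨fun h => ?_, fun p _ _ h => h.areEquivalent_lpUnitBasis he hsub⟩,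
    fun h => h.subsequencesHaveEquivalentBlocks he, fun h => h.subsequencesHaveEquivalentBlocks he⟩
  obtain ⟨C, hC, hCe⟩ := IsAsymptoticallyLp.areEquivalent_lpUnitBasis he hsub h
  refine ⟨C, hC, fun a => ?_⟩
  rw [norm_linearCombination_c0UnitBasis]
  exact hCe a
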